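/- Let $A$ be an alphabet with exactly two letters. A bi-infinite word is a map $w:\mathbb Z\to A$, and two such words are equal up to shift if one is obtained from the other by a translation of $\mathbb Z$. A finite word is a subword of $w$ if it occurs in $w$ as a block of consecutive letters. A set $S$ of finite words (forbidden words) defines $w$ if no element of $S$ is a subword of $w$ and every bi-infinite word over $A$ with this property is equal to $w$ up to shift. Let $(\varphi_c)$ be the Fibonacci sequence indexed by $\varphi_1=1$, $\varphi_2=2$, $\varphi_{c+2}=\varphi_{c+1}+\varphi_c$ (so $\varphi_3=3$, $\varphi_4=5$, and $\varphi_0=1$). **Theorem.** If a bi-infinite word $w$ over $A$ with least period $n\ge 1$ is defined by a set of exactly $c$ forbidden words, where $c$ is finite, then $\varphi_c\ge n$. Consequently $c\ge\log_{\varphi} n$, where $\varphi=\frac{1+\sqrt5}{2}$ is the golden ratio. -/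

import Mathlib

/-- A bi-infinite word over the alphabet `A`. -/
abbrev BiWord (A : Type*) := ℤ → A

namespace BiWord

variable {A : Type*}

/-- The finite word `s` occurs in the bi-infinite word `w` as a block of consecutive letters. -/
def IsSubword (s : List A) (w : BiWord A) : Prop :=
  ∃ i : ℤ, ∀ j : Fin s.length, w (i + (j : ℕ)) = s.get j

/-- `w` avoids every forbidden word of the system `S`. -/
def Satisfies (w : BiWord A) (S : Set (List A)) : Prop :=
  ∀ s ∈ S, ¬ IsSubword s w

/-- Two bi-infinite words are equal up to shift. -/
def ShiftEquiv (v w : BiWord A) : Prop :=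
  ∃ k : ℤ, ∀ i : ℤ, v i = w (i + k)

/-- The system `S` of forbidden words defines `w`: the word `w`, considered up to shift, satisfies
`S`, and it is the only bi-infinite word up to shift that does. -/
def DefinedBy (w : BiWord A) (S : Set (List A)) : Prop :=
  w.Satisfies S ∧ ∀ v : BiWord A, v.Satisfies S → ShiftEquiv v w

/-- `n` is the least (positive) period of `w`. -/
def HasLeastPeriod (w : BiWord A) (n : ℕ) : Prop :=
  IsLeast {p : ℕ | 0 < p ∧ Function.Periodic w (p : ℤ)} n

end BiWord

/-! Call a word minimal forbidden for `w` if it does not occur in `w` but both words got by deleting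
an end letter do; only those of length at least two are counted. Let `M(w)` be their number. The
theorem splits into `M(w) ≤ c` and `n ≤ fib (M(w) + 1)`.

For the first (`ncard_minForbidden_le`), glue two pieces of `w` along a minimal forbidden word `a y
b`. The result is not a shift of `w`, so it contains some `s ∈ S`, and `s` must contain `a y b`;
this assignment of `s` to `a y b` is injective.

The second (`le_fib_ncard_minForbidden`) is an induction on `n`. Let `x` be a longest block
occurring at two positions distinct modulo `n`. Cutting one period at these two occurrences gives
two shorter periodic words, of least periods `p` and `q` with `p + q = n`. Each has fewer minimal
forbidden words than `w` (`IsSplit.ncard_add_one_le`), and if `p, q ≥ 2`, one of the two has at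
least two fewer (`IsSplit.ncard_add_two_le`). This is the Fibonacci recursion.

To compare the counts, extend a minimal forbidden word of the cut word `U` to the left inside `U`,
until it becomes minimal forbidden for `w` or becomes the word at which `w` leaves `U`. If both cuts
lost exactly one, these extensions would be so constrained (`Stuck`) that `x` would have two
incompatible borders (`not_stuck`). -/

namespace ForbiddenWords

/-! ### Factorial languages and minimal forbidden words -/

variable {A : Type*}

/-- A factorial extendable language: closed under factors, and each word extends on both sides. -/
structure IsFactorial (L : Set (List A)) : Prop where
  infix_mem : ∀ {l l' : List A}, l <:+: l' → l' ∈ L → l ∈ L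
  exists_cons : ∀ {l : List A}, l ∈ L → ∃ a, a :: l ∈ L
  exists_concat : ∀ {l : List A}, l ∈ L → ∃ b, l ++ [b] ∈ L

/-- The word `a y b` coded by the triple `(a, y, b)`. -/
def toWord (t : A × List A × A) : List A := t.1 :: (t.2.1 ++ [t.2.2])

/-- Minimal forbidden words of length at least two, coded as triples. -/
def minForbidden (L : Set (List A)) : Set (A × List A × A) :=
  {t | t.1 :: t.2.1 ∈ L ∧ t.2.1 ++ [t.2.2] ∈ L ∧ toWord t ∉ L}

theorem toWord_injective : Function.Injective (toWord (A := A)) := by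
  rintro ⟨a, y, b⟩ ⟨a', y', b'⟩ h
  simp only [toWord, List.cons.injEq] at h
  obtain ⟨rfl, h⟩ := h
  have := List.append_inj' h rfl
  simp_all

/-- The language of reversed words. -/
def rev (L : Set (List A)) : Set (List A) := {l | l.reverse ∈ L}

theorem IsFactorial.rev {L : Set (List A)} (h : IsFactorial L) : IsFactorial (rev L) where
  infix_mem hl hl' := h.infix_mem (List.reverse_infix.2 hl) hl'
  exists_cons {l} hl := by
    obtain ⟨b, hb⟩ := h.exists_concat hl
    exact ⟨b, by simpa [ForbiddenWords.rev] using hb⟩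
  exists_concat {l} hl := by
    obtain ⟨b, hb⟩ := h.exists_cons hl
    exact ⟨b, by simpa [ForbiddenWords.rev] using hb⟩

/-- `U` is the language of one of the two periodic words obtained by cutting the periodic word with
language `W` at the two occurrences `c x d'` and `c' x d` of a longest repeated word `x`. -/
structure IsSplit (W U : Set (List A)) (x : List A) (c d c' d' : A) : Prop where
  factW : IsFactorial W
  factU : IsFactorial U
  detW : ∀ {z : List A} {b b' : A}, z.length = x.length + 1 →
    z ++ [b] ∈ W → z ++ [b'] ∈ W → b = b'
  -- The co-deterministic conditions make the structure stable under reversal, so that each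
  -- left-hand argument yields its right-hand mirror image.
  codetW : ∀ {z : List A} {b b' : A}, z.length = x.length + 1 → b :: z ∈ W → b' :: z ∈ W → b = b'
  detU : ∀ {z : List A} {b b' : A}, z.length = x.length + 1 →
    z ++ [b] ∈ U → z ++ [b'] ∈ U → b = b'
  codetU : ∀ {z : List A} {b b' : A}, z.length = x.length + 1 → b :: z ∈ U → b' :: z ∈ U → b = b'
  sub : ∀ {l : List A}, l ∈ U → l.length ≤ x.length + 1 → l ∈ W
  new : ∀ {l : List A}, l ∈ U → l.length = x.length + 2 → l ∈ W ∨ l = c' :: (x ++ [d'])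
  cons_eq : ∀ {a : A}, a :: x ∈ U → a = c'
  concat_eq : ∀ {b : A}, x ++ [b] ∈ U → b = d'
  memU : c' :: (x ++ [d']) ∈ U
  mem_right : c' :: (x ++ [d]) ∈ W
  mem_left : c :: (x ++ [d']) ∈ W
  ne_left : c ≠ c'
  ne_right : d ≠ d'

/-! ### Each cut loses at least one minimal forbidden word -/

namespace IsSplit

variable {W U : Set (List A)} {x : List A} {c d c' d' : A}

theorem rev (h : IsSplit W U x c d c' d') :
    IsSplit (rev W) (rev U) x.reverse d c d' c' where
  factW := h.factW.rev
  factU := h.factU.rev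
  detW {z b b'} hz h1 h2 := h.codetW (z := z.reverse) (by simpa using hz)
    (by simpa [ForbiddenWords.rev] using h1) (by simpa [ForbiddenWords.rev] using h2)
  codetW {z b b'} hz h1 h2 := h.detW (z := z.reverse) (by simpa using hz)
    (by simpa [ForbiddenWords.rev] using h1) (by simpa [ForbiddenWords.rev] using h2)
  detU {z b b'} hz h1 h2 := h.codetU (z := z.reverse) (by simpa using hz)
    (by simpa [ForbiddenWords.rev] using h1) (by simpa [ForbiddenWords.rev] using h2)
  codetU {z b b'} hz h1 h2 := h.detU (z := z.reverse) (by simpa using hz)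
    (by simpa [ForbiddenWords.rev] using h1) (by simpa [ForbiddenWords.rev] using h2)
  sub {l} hl hlen := h.sub (l := l.reverse) hl (by simpa using hlen)
  new {l} hl hlen := by
    rcases h.new (l := l.reverse) hl (by simpa using hlen) with h1 | h1
    · exact Or.inl h1
    · right
      rw [← List.reverse_reverse l, h1]
      simp
  cons_eq {a} ha := h.concat_eq (by simpa [ForbiddenWords.rev] using ha)
  concat_eq {a} ha := h.cons_eq (by simpa [ForbiddenWords.rev] using ha)
  memU := by simpa [ForbiddenWords.rev] using h.memU
  mem_right := by simpa [ForbiddenWords.rev] using h.mem_left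
  mem_left := by simpa [ForbiddenWords.rev] using h.mem_right
  ne_left := h.ne_right
  ne_right := h.ne_left

theorem notMem_right (h : IsSplit W U x c d c' d') : c' :: (x ++ [d']) ∉ W := fun h1 =>
  h.ne_right (h.detW (z := c' :: x) (by simp) h.mem_right h1)

theorem notMem_left (h : IsSplit W U x c d c' d') : c :: (x ++ [d]) ∉ W := fun h1 =>
  h.ne_right (h.detW (z := c :: x) (by simp) h1 h.mem_left)

theorem detW_of_le (h : IsSplit W U x c d c' d') {z : List A} {b b' : A}
    (hz : x.length + 1 ≤ z.length) (h1 : z ++ [b] ∈ W) (h2 : z ++ [b'] ∈ W) : b = b' := by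
  have e : z = z.take (z.length - (x.length + 1)) ++ z.drop (z.length - (x.length + 1)) := by simp
  refine h.detW (z := z.drop (z.length - (x.length + 1))) (by simp; omega)
    (h.factW.infix_mem (List.IsSuffix.isInfix ?_) h1)
    (h.factW.infix_mem (List.IsSuffix.isInfix ?_) h2)
  all_goals
    exact ⟨z.take (z.length - (x.length + 1)), by rw [← List.append_assoc, ← e]⟩

theorem detU_of_le (h : IsSplit W U x c d c' d') {z : List A} {b b' : A}
    (hz : x.length + 1 ≤ z.length) (h1 : z ++ [b] ∈ U) (h2 : z ++ [b'] ∈ U) : b = b' := by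
  have e : z = z.take (z.length - (x.length + 1)) ++ z.drop (z.length - (x.length + 1)) := by simp
  refine h.detU (z := z.drop (z.length - (x.length + 1))) (by simp; omega)
    (h.factU.infix_mem (List.IsSuffix.isInfix ?_) h1)
    (h.factU.infix_mem (List.IsSuffix.isInfix ?_) h2)
  all_goals
    exact ⟨z.take (z.length - (x.length + 1)), by rw [← List.append_assoc, ← e]⟩

/-- A middle part longer than `x` has only one continuation in `W`, so the continuation of `a y`
would have to be `b`. -/
theorem length_le_of_mem_minForbidden (h : IsSplit W U x c d c' d') {t : A × List A × A}
    (ht : t ∈ minForbidden W) : t.2.1.length ≤ x.length := by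
  obtain ⟨a, y, b⟩ := t
  obtain ⟨h1, h2, h3⟩ := ht
  by_contra! hlt
  obtain ⟨b', hb'⟩ := h.factW.exists_concat h1
  have h4 : y ++ [b'] ∈ W := h.factW.infix_mem (List.suffix_cons a _).isInfix (by simpa using hb')
  obtain rfl := h.detW_of_le hlt h2 h4
  exact h3 (by simpa [toWord] using hb')

theorem length_le_of_mem_minForbidden' (h : IsSplit W U x c d c' d') {t : A × List A × A}
    (ht : t ∈ minForbidden U) : t.2.1.length ≤ x.length := by
  obtain ⟨a, y, b⟩ := t
  obtain ⟨h1, h2, h3⟩ := ht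
  by_contra! hlt
  obtain ⟨b', hb'⟩ := h.factU.exists_concat h1
  have h4 : y ++ [b'] ∈ U := h.factU.infix_mem (List.suffix_cons a _).isInfix (by simpa using hb')
  obtain rfl := h.detU_of_le hlt h2 h4
  exact h3 (by simpa [toWord] using hb')

theorem finite_minForbidden [Finite A] (h : IsSplit W U x c d c' d') : (minForbidden W).Finite := by
  refine Set.Finite.subset ((Set.finite_univ (α := A)).prod
    ((List.finite_length_le A x.length).prod (Set.finite_univ (α := A)))) fun t ht => ?_
  exact ⟨trivial, h.length_le_of_mem_minForbidden ht, trivial⟩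

/-- Minimal forbidden words of `W` with left end in `U`, other than the two around `x`, together
with the word by which `W` leaves `U`. -/
def leftTarget (W U : Set (List A)) (x : List A) (c' d : A) : Set (A × List A × A) :=
  insert (c', x, d) {t | t ∈ minForbidden W ∧ t.2.1 ≠ x ∧ t.1 :: t.2.1 ∈ U}

/-- Prepend letters to `l` inside `U` as long as `l b` stays in `W`. If this fails, a minimal
forbidden word of `W` has been found. If it never fails before length `|x| + 1`, then `l` continues
in `U` otherwise than in `W`, which happens only for `l = c' x`, and then `b = d`. -/
theorem exists_extension (hA : ∀ a b e : A, a ≠ b → e = a ∨ e = b)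
    (h : IsSplit W U x c d c' d') {f l : List A} {b : A} (hfU : f ++ [b] ∉ U)
    (hl : l ∈ U) (hlen : l.length ≤ x.length + 1) (hlb : l ++ [b] ∈ W) (hfl : f <:+ l) :
    ∃ g ∈ leftTarget W U x c' d, f ++ [b] <:+ toWord g := by
  have hcontra : ∀ l : List A, f <:+ l → l ++ [b] ∉ U := fun l hl h1 =>
    hfU (h.factU.infix_mem (List.IsSuffix.isInfix (by
      obtain ⟨s, rfl⟩ := hl; exact ⟨s, by simp⟩)) h1)
  induction hk : x.length + 1 - l.length generalizing l with
  | zero =>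
    have hlen' : l.length = x.length + 1 := by omega
    obtain ⟨b', hb'⟩ := h.factU.exists_concat hl
    rcases h.new hb' (by simp [hlen']) with h1 | h1
    · obtain rfl := h.detW hlen' h1 hlb
      exact absurd hb' (hcontra l hfl)
    · obtain ⟨h2, h3⟩ := List.append_inj' (h1.trans (List.cons_append ..).symm) rfl
      subst h2
      have : b = d := h.detW hlen' hlb (by simpa using h.mem_right)
      subst this
      refine ⟨_, Set.mem_insert _ _, ?_⟩
      obtain ⟨s, hs⟩ := hfl
      exact ⟨s, by rw [← List.append_assoc, hs]; simp [toWord]⟩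
  | succ k ih =>
    obtain ⟨e, he⟩ := h.factU.exists_cons hl
    have hfe : f <:+ e :: l := hfl.trans (List.suffix_cons e l)
    by_cases hW : (e :: l) ++ [b] ∈ W
    · exact ih he (by simp; omega) hW hfe (by simp; omega)
    · refine ⟨(e, l, b), Or.inr ⟨⟨h.sub he (by simp; omega), hlb, by simpa [toWord] using hW⟩, ?_, he⟩,
        ?_⟩
      -- The middle cannot be `x`: in `U` only `c'` precedes `x`, and `c' x d` lies in `W` while `c'
      -- x d'` lies in `U`.
      · rintro rfl
        obtain rfl := h.cons_eq he
        rcases hA d d' b h.ne_right with rfl | rfl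
        · exact hW (by simpa using h.mem_right)
        · exact hcontra _ hfe (by simpa using h.memU)
      · obtain ⟨s, hs⟩ := hfe
        exact ⟨s, by rw [← List.append_assoc, hs]; simp [toWord]⟩

theorem exists_leftTarget (hA : ∀ a b e : A, a ≠ b → e = a ∨ e = b)
    (h : IsSplit W U x c d c' d') {t : A × List A × A} (ht : t ∈ minForbidden U) :
    ∃ g ∈ leftTarget W U x c' d, toWord t <:+ toWord g := by
  have hlen := h.length_le_of_mem_minForbidden' ht
  obtain ⟨a, y, b⟩ := t
  obtain ⟨h1, h2, h3⟩ := ht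
  simp only at h1 h2 hlen
  by_cases hW : toWord (a, y, b) ∈ W
  · simpa [toWord] using h.exists_extension hA (f := a :: y) (l := a :: y) (b := b)
      (by simpa [toWord] using h3) h1 (by simpa using hlen) (by simpa [toWord] using hW)
      List.suffix_rfl
  · refine ⟨(a, y, b), Or.inr ⟨⟨h.sub h1 (by simpa using hlen), h.sub h2 (by simpa using hlen), hW⟩,
      ?_, h1⟩, List.suffix_rfl⟩
    rintro rfl
    obtain rfl := h.cons_eq h1
    obtain rfl := h.concat_eq h2
    exact h3 h.memU

theorem eq_of_suffix (hU : IsFactorial U) {s t : A × List A × A} (hs : s ∈ minForbidden U)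
    (ht : t ∈ minForbidden U) (h : toWord s <:+ toWord t) : s = t := by
  rcases List.suffix_cons_iff.1 h with h1 | h1
  · exact toWord_injective h1
  · exact absurd (hU.infix_mem h1.isInfix ht.2.1) hs.2.2

/-- Two suffixes of one word are comparable, and comparable minimal forbidden words coincide; hence
sending a minimal forbidden word of `U` to its extension is injective. -/
theorem ncard_le_leftTarget [Finite A] (hA : ∀ a b e : A, a ≠ b → e = a ∨ e = b)
    (h : IsSplit W U x c d c' d') :
    (minForbidden U).ncard ≤ {t | t ∈ minForbidden W ∧ t.2.1 ≠ x ∧ t.1 :: t.2.1 ∈ U}.ncard + 1 := by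
  choose! φ hφ hsuf using fun t (ht : t ∈ minForbidden U) => h.exists_leftTarget hA ht
  have hfin : {t | t ∈ minForbidden W ∧ t.2.1 ≠ x ∧ t.1 :: t.2.1 ∈ U}.Finite :=
    h.finite_minForbidden.subset fun t ht => ht.1
  refine (Set.ncard_le_ncard_of_injOn φ hφ ?_ (hfin.insert _)).trans (Set.ncard_insert_le _ _)
  intro s hs t ht hst
  have h1 := hsuf s hs
  rw [hst] at h1
  rcases List.suffix_or_suffix_of_suffix h1 (hsuf t ht) with h2 | h2
  · exact eq_of_suffix h.factU hs ht h2
  · exact (eq_of_suffix h.factU ht hs h2).symm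

/-- The two words set aside are `c x d` and `c' x d'`. Since `leftTarget` adds back only `c' x d`,
the net loss is at least one. -/
theorem ncard_ne_add_two_le [Finite A] (h : IsSplit W U x c d c' d') :
    {t | t ∈ minForbidden W ∧ t.2.1 ≠ x}.ncard + 2 ≤ (minForbidden W).ncard := by
  have hsub : {t | t ∈ minForbidden W ∧ t.2.1 ≠ x} ∪ {(c, x, d), (c', x, d')} ⊆ minForbidden W := by
    rintro t (ht | rfl | rfl)
    · exact ht.1
    · exact ⟨h.factW.infix_mem ⟨[], [d'], by simp⟩ h.mem_left,
        h.factW.infix_mem (List.suffix_cons _ _).isInfix h.mem_right, h.notMem_left⟩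
    · exact ⟨h.factW.infix_mem ⟨[], [d], by simp⟩ h.mem_right,
        h.factW.infix_mem (List.suffix_cons _ _).isInfix h.mem_left, h.notMem_right⟩
  have hfin := h.finite_minForbidden
  refine le_trans (le_of_eq ?_) (Set.ncard_le_ncard hsub hfin)
  rw [Set.ncard_union_eq ?_ (hfin.subset fun t ht => ht.1) (Set.toFinite _), Set.ncard_pair]
  · intro he
    exact h.ne_left (congrArg Prod.fst he)
  · rw [Set.disjoint_left]
    rintro t ⟨-, ht⟩ (rfl | rfl) <;> exact ht rfl

theorem ncard_add_one_le [Finite A] (hA : ∀ a b e : A, a ≠ b → e = a ∨ e = b)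
    (h : IsSplit W U x c d c' d') : (minForbidden U).ncard + 1 ≤ (minForbidden W).ncard := by
  have h1 := h.ncard_le_leftTarget hA
  have h2 := h.ncard_ne_add_two_le
  have h3 : {t | t ∈ minForbidden W ∧ t.2.1 ≠ x ∧ t.1 :: t.2.1 ∈ U}.ncard ≤
      {t | t ∈ minForbidden W ∧ t.2.1 ≠ x}.ncard :=
    Set.ncard_le_ncard (fun t ht => ⟨ht.1, ht.2.1⟩) (h.finite_minForbidden.subset fun t ht => ht.1)
  omega

/-- The word `t` is missing from `leftTarget`, which costs one more. -/
theorem ncard_add_two_le_of_left [Finite A] (hA : ∀ a b e : A, a ≠ b → e = a ∨ e = b)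
    (h : IsSplit W U x c d c' d') {t : A × List A × A} (ht : t ∈ minForbidden W) (htx : t.2.1 ≠ x)
    (htU : t.1 :: t.2.1 ∉ U) : (minForbidden U).ncard + 2 ≤ (minForbidden W).ncard := by
  have h1 := h.ncard_le_leftTarget hA
  have h2 := h.ncard_ne_add_two_le
  have h3 : {t | t ∈ minForbidden W ∧ t.2.1 ≠ x ∧ t.1 :: t.2.1 ∈ U}.ncard <
      {t | t ∈ minForbidden W ∧ t.2.1 ≠ x}.ncard := by
    refine Set.ncard_lt_ncard ?_ (h.finite_minForbidden.subset fun t ht => ht.1)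
    refine ⟨fun t ht => ⟨ht.1, ht.2.1⟩, fun hsub => htU (hsub ⟨ht, htx⟩).2.2⟩
  omega

end IsSplit

/-- Reversal of triples. -/
def revTriple : A × List A × A ≃ A × List A × A where
  toFun t := (t.2.2, t.2.1.reverse, t.1)
  invFun t := (t.2.2, t.2.1.reverse, t.1)
  left_inv t := by simp
  right_inv t := by simp

theorem toWord_revTriple (t : A × List A × A) : toWord (revTriple t) = (toWord t).reverse := by
  simp [toWord, revTriple]

theorem revTriple_mem_iff {L : Set (List A)} {t : A × List A × A} :
    revTriple t ∈ minForbidden (rev L) ↔ t ∈ minForbidden L := by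
  simp only [minForbidden, Set.mem_ofPred_eq, toWord_revTriple]
  simp only [rev, revTriple, Equiv.coe_fn_mk, Set.mem_ofPred_eq, List.reverse_cons,
    List.reverse_reverse, List.reverse_append, List.reverse_nil, List.nil_append,
    List.cons_append]
  tauto

theorem ncard_minForbidden_rev (L : Set (List A)) :
    (minForbidden (rev L)).ncard = (minForbidden L).ncard := by
  have : minForbidden (rev L) = revTriple '' minForbidden L := by
    ext t
    rw [Equiv.image_eq_preimage_symm, Set.mem_preimage, ← revTriple_mem_iff (L := L),
      Equiv.apply_symm_apply]
  rw [this, Set.ncard_image_of_injective _ revTriple.injective]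

/-! ### One of the two cuts loses at least two -/

namespace IsSplit

variable {W U V : Set (List A)} {x : List A} {c d c' d' : A}

theorem ncard_add_two_le_of_right [Finite A] (hA : ∀ a b e : A, a ≠ b → e = a ∨ e = b)
    (h : IsSplit W U x c d c' d') {t : A × List A × A} (ht : t ∈ minForbidden W) (htx : t.2.1 ≠ x)
    (htU : t.2.1 ++ [t.2.2] ∉ U) : (minForbidden U).ncard + 2 ≤ (minForbidden W).ncard := by
  rw [← ncard_minForbidden_rev U, ← ncard_minForbidden_rev W]
  refine h.rev.ncard_add_two_le_of_left hA (revTriple_mem_iff.2 ht) ?_ ?_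
  · simpa [revTriple] using htx
  · simpa [revTriple, ForbiddenWords.rev] using htU

/-- Every minimal forbidden word of `W`, other than the two around `x`, has both ends in `U`. -/
def Stuck (W U : Set (List A)) (x : List A) : Prop :=
  ∀ t ∈ minForbidden W, t.2.1 ≠ x → t.1 :: t.2.1 ∈ U ∧ t.2.1 ++ [t.2.2] ∈ U

theorem Stuck.rev (h : Stuck W U x) :
    Stuck (ForbiddenWords.rev W) (ForbiddenWords.rev U) x.reverse := by
  intro t ht htx
  obtain ⟨t, rfl⟩ := revTriple.surjective t
  have := h t (revTriple_mem_iff.1 ht) (by simpa [revTriple] using htx)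
  simpa [revTriple, ForbiddenWords.rev, and_comm] using this

/-- Otherwise the word is a suffix of a minimal forbidden word `g` of `W`. It differs from `g`
because it lies in `W`, so it sits inside the right end of `g`, which is in `U` by stuckness. -/
theorem suffix_of_stuck (hA : ∀ a b e : A, a ≠ b → e = a ∨ e = b)
    (h : IsSplit W U x c d c' d') (hs : Stuck W U x) {t : A × List A × A}
    (ht : t ∈ minForbidden U) (htW : toWord t ∈ W) : toWord t <:+ toWord (c', x, d) := by
  obtain ⟨g, rfl | ⟨h1, h2, h3⟩, hg⟩ := h.exists_leftTarget hA ht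
  · exact hg
  · rcases List.suffix_cons_iff.1 hg with h4 | h4
    · exact absurd htW (h4.symm ▸ h1.2.2)
    · exact absurd (h.factU.infix_mem h4.isInfix (hs g h1 h2).2) ht.2.2

theorem prefix_of_stuck (hA : ∀ a b e : A, a ≠ b → e = a ∨ e = b)
    (h : IsSplit W U x c d c' d') (hs : Stuck W U x) {t : A × List A × A}
    (ht : t ∈ minForbidden U) (htW : toWord t ∈ W) : toWord t <+: toWord (c, x, d') := by
  have := h.rev.suffix_of_stuck hA hs.rev (revTriple_mem_iff.2 ht)
    (by simpa [toWord_revTriple, ForbiddenWords.rev] using htW)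
  rw [toWord_revTriple] at this
  rw [← List.reverse_suffix]
  simpa [toWord] using this

/-- Take a shortest word of `W` outside `U`; `c x` shows that one exists. The letters being in `U`
forces its length to be at least two. -/
theorem exists_mem_minForbidden (h : IsSplit W U x c d c' d') (hlet : ∀ a, [a] ∈ U) :
    ∃ t ∈ minForbidden U, toWord t ∈ W := by
  have hex : ∃ k, ∃ l ∈ W, l ∉ U ∧ l.length = k :=
    ⟨_, c :: x, h.factW.infix_mem ⟨[], [d'], by simp⟩ h.mem_left,
      fun h1 => h.ne_left (h.cons_eq h1), rfl⟩
  classical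
  obtain ⟨l, hlW, hlU, hlen⟩ := Nat.find_spec hex
  have hmin : ∀ l' ∈ W, l'.length < l.length → l' ∈ U := by
    intro l' hl' hlt
    by_contra hU
    exact Nat.find_min hex (hlen ▸ hlt) ⟨l', hl', hU, rfl⟩
  match l, hlW, hlU, hmin with
  | [], _, hlU, _ => exact absurd (h.factU.infix_mem (List.nil_infix) h.memU) hlU
  | a :: l, hlW, hlU, hmin =>
    rcases List.eq_nil_or_concat l with rfl | ⟨y, b, rfl⟩
    · exact absurd (hlet a) hlU
    · refine ⟨(a, y, b), ⟨hmin _ (h.factW.infix_mem ⟨[], [b], by simp⟩ hlW) (by simp),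
        hmin _ (h.factW.infix_mem (List.suffix_cons _ _).isInfix (by simpa using hlW)) (by simp),
        by simpa [toWord] using hlU⟩, by simpa [toWord] using hlW⟩

/-- A minimal forbidden word of `U` lying in `W` is both a suffix of `c' x d` and a prefix of `c x
d'`. As `c ≠ c'` and `d ≠ d'`, it is `c y d` with the stated overlaps. -/
theorem exists_border (hA : ∀ a b e : A, a ≠ b → e = a ∨ e = b)
    (h : IsSplit W U x c d c' d') (hs : Stuck W U x) (hlet : ∀ a, [a] ∈ U) :
    ∃ y, c :: y <:+ x ∧ y ++ [d] <+: x ∧ c :: (y ++ [d]) ∉ U := by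
  obtain ⟨⟨a, y, b⟩, ht, htW⟩ := h.exists_mem_minForbidden hlet
  have h1 := h.suffix_of_stuck hA hs ht htW
  have h2 := h.prefix_of_stuck hA hs ht htW
  simp only [toWord] at h1 h2
  obtain ⟨rfl, h3⟩ := List.cons_prefix_cons.1 h2
  rcases List.suffix_cons_iff.1 h1 with h4 | h4
  · exact absurd (List.cons.inj h4).1 h.ne_left
  · rw [← List.cons_append] at h4
    obtain ⟨s, hs⟩ := h4
    rw [← List.append_assoc] at hs
    obtain ⟨h5, h6⟩ := List.append_inj' hs rfl
    obtain rfl : b = d := by simpa using h6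
    refine ⟨y, ⟨s, h5⟩, ?_, ht.2.2⟩
    rcases List.prefix_concat_iff.1 h3 with h7 | h7
    · exact absurd (by simpa using (List.append_inj' h7 rfl).2) h.ne_right
    · exact h7

/-- Here `c y` is a suffix of `y'`, so no word ending in `c y` can be followed by `d` in `U`. With
stuckness this lets a word followed in `W` by both `d` and `d'` be extended to the left
indefinitely, against determinism beyond length `|x|`. -/
theorem false_of_nested (hA : ∀ a b e : A, a ≠ b → e = a ∨ e = b)
    (h : IsSplit W U x c d c' d') (hs : Stuck W U x) {y y' : List A}
    (h1 : c :: y <:+ x) (h2 : y ++ [d] <+: x) (hU : c :: (y ++ [d]) ∉ U)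
    (h1' : c' :: y' <:+ x) (h2' : y' ++ [d'] <+: x) (hlt : y.length < y'.length) : False := by
  have hy' : y' <+: x := (List.prefix_append _ _).trans h2'
  have hy's : c :: y <:+ y' :=
    List.suffix_of_suffix_length_le h1 ((List.suffix_cons _ _).trans h1') (by simpa using hlt)
  have hnot : ∀ Z : List A, c :: y <:+ Z → Z ++ [d] ∉ U := fun Z ⟨s, hZ⟩ hm =>
    hU (h.factU.infix_mem ⟨s, [], by rw [← hZ]; simp⟩ hm)
  have extd : ∀ (Z : List A) (e : A), c :: y <:+ Z → Z ≠ x → e :: Z ∈ W → Z ++ [d] ∈ W →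
      e :: (Z ++ [d]) ∈ W := by
    intro Z e hZ hZx h3 h4
    by_contra h5
    exact hnot Z hZ (hs (e, Z, d) ⟨h3, h4, h5⟩ hZx).2
  have extd' : ∀ (Z : List A) (e : A), c :: y <:+ Z → Z ≠ x → e :: Z ∈ W → Z ++ [d'] ∈ W →
      e :: (Z ++ [d']) ∈ W := by
    intro Z e hZ hZx h3 h4
    by_contra h5
    have hmf : (e, Z, d') ∈ minForbidden W := ⟨h3, h4, h5⟩
    have hlen := h.length_le_of_mem_minForbidden hmf
    -- The continuation of `e Z` in `U` cannot be `d`, so it is `d'`; at this length `U` exceeds `W`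
    -- only by `c' x d'`, excluded by `Z ≠ x`.
    obtain ⟨b, hb⟩ := h.factU.exists_concat (hs _ hmf hZx).1
    rcases hA d d' b h.ne_right with rfl | rfl
    · exact hnot (e :: Z) (hZ.trans (List.suffix_cons _ _)) hb
    · simp only [List.cons_append] at hb
      simp only at hlen
      rcases hlen.lt_or_eq with h6 | h6
      · exact h5 (h.sub hb (by simp; omega))
      · rcases h.new hb (by simp; omega) with h7 | h7
        · exact h5 h7
        · exact hZx (List.append_inj' (List.cons.inj h7).2 rfl).1
  have hy'x : y' ≠ x := by
    rintro rfl
    have := h2'.length_le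
    simp at this
  have hxW : c :: x ∈ W := h.factW.infix_mem ⟨[], [d'], by simp⟩ h.mem_left
  have hcy' : c :: y' ∈ W :=
    h.factW.infix_mem (List.IsPrefix.isInfix (List.cons_prefix_cons.2 ⟨rfl, hy'⟩)) hxW
  have hsx : ∀ b, x ++ [b] ∈ W → y' ++ [b] ∈ W := by
    intro b hb
    obtain ⟨s, hsy⟩ := (List.suffix_cons _ _).trans h1'
    exact h.factW.infix_mem ⟨s, [], by rw [← hsy]; simp⟩ hb
  have hxd : x ++ [d] ∈ W := h.factW.infix_mem (List.suffix_cons _ _).isInfix h.mem_right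
  have hxd' : x ++ [d'] ∈ W := h.factW.infix_mem (List.suffix_cons _ _).isInfix h.mem_left
  have key : ∀ k : ℕ, ∃ Z : List A, k ≤ Z.length ∧ c :: y' <:+ Z ∧ Z ++ [d] ∈ W ∧
      Z ++ [d'] ∈ W := by
    intro k
    induction k with
    | zero =>
      exact ⟨c :: y', Nat.zero_le _, List.suffix_rfl, extd y' c hy's hy'x hcy' (hsx d hxd),
        extd' y' c hy's hy'x hcy' (hsx d' hxd')⟩
    | succ k ih =>
      obtain ⟨Z, hk, hZ, hd, hd'⟩ := ih
      obtain ⟨e, he⟩ := h.factW.exists_cons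
        (h.factW.infix_mem (List.prefix_append Z [d]).isInfix hd)
      have hZy : c :: y <:+ Z := hy's.trans ((List.suffix_cons _ _).trans hZ)
      -- `Z` ends in `c y'` whereas `x` ends in `c' y'`.
      have hZx : Z ≠ x := by
        rintro rfl
        have h3 := (List.suffix_of_suffix_length_le hZ h1' (by simp)).eq_of_length (by simp)
        exact h.ne_left (List.cons.inj h3).1
      exact ⟨e :: Z, by simpa using hk, hZ.trans (List.suffix_cons _ _),
        extd Z e hZy hZx he hd, extd' Z e hZy hZx he hd'⟩
  obtain ⟨Z, hk, -, hd, hd'⟩ := key (x.length + 1)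
  exact h.ne_right (h.detW_of_le hk hd hd')

/-- The two cuts give borders `y` and `y'`. Equal lengths would make `y d` and `y' d'` the same
prefix of `x`; unequal lengths are the nested case, up to exchanging the cuts. -/
theorem not_stuck (hA : ∀ a b e : A, a ≠ b → e = a ∨ e = b)
    (hU : IsSplit W U x c d c' d') (hV : IsSplit W V x c' d' c d)
    (hletU : ∀ a, [a] ∈ U) (hletV : ∀ a, [a] ∈ V) (hsU : Stuck W U x) (hsV : Stuck W V x) :
    False := by
  obtain ⟨y, h1, h2, h3⟩ := hU.exists_border hA hsU hletU
  obtain ⟨y', h1', h2', h3'⟩ := hV.exists_border hA hsV hletV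
  rcases lt_trichotomy y.length y'.length with hlt | heq | hlt
  · exact hU.false_of_nested hA hsU h1 h2 h3 h1' h2' hlt
  · have h4 := (List.prefix_of_prefix_length_le h2 h2' (by simp [heq])).eq_of_length
      (by simp [heq])
    exact hU.ne_right (by simpa using (List.append_inj' h4 rfl).2)
  · exact hV.false_of_nested hA hsV h1' h2' h3' h1 h2 hlt

theorem ncard_add_two_le [Finite A] (hA : ∀ a b e : A, a ≠ b → e = a ∨ e = b)
    (hU : IsSplit W U x c d c' d') (hV : IsSplit W V x c' d' c d)
    (hletU : ∀ a, [a] ∈ U) (hletV : ∀ a, [a] ∈ V) :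
    (minForbidden U).ncard + 2 ≤ (minForbidden W).ncard ∨
      (minForbidden V).ncard + 2 ≤ (minForbidden W).ncard := by
  by_contra! hcon
  refine not_stuck hA hU hV hletU hletV (fun t ht htx => ⟨?_, ?_⟩) (fun t ht htx => ⟨?_, ?_⟩)
  · by_contra h1
    exact absurd (hU.ncard_add_two_le_of_left hA ht htx h1) (by omega)
  · by_contra h1
    exact absurd (hU.ncard_add_two_le_of_right hA ht htx h1) (by omega)
  · by_contra h1
    exact absurd (hV.ncard_add_two_le_of_left hA ht htx h1) (by omega)
  · by_contra h1
    exact absurd (hV.ncard_add_two_le_of_right hA ht htx h1) (by omega)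

end IsSplit

end ForbiddenWords

/-! ### Periodic words and their cuts -/

namespace ForbiddenWords

open BiWord

variable {A : Type*}

/-- The block of length `k` of `w` starting at position `i`. -/
def window (w : BiWord A) (i : ℤ) (k : ℕ) : List A := List.ofFn fun j : Fin k => w (i + (j : ℕ))

/-- The language of finite subwords of `w`. -/
def lang (w : BiWord A) : Set (List A) := {s | IsSubword s w}

@[simp] theorem length_window (w : BiWord A) (i : ℤ) (k : ℕ) : (window w i k).length = k := by
  simp [window]

theorem window_succ (w : BiWord A) (i : ℤ) (k : ℕ) :
    window w i (k + 1) = w i :: window w (i + 1) k := by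
  simp [window, List.ofFn_succ, add_comm, add_left_comm]

theorem window_succ' (w : BiWord A) (i : ℤ) (k : ℕ) :
    window w i (k + 1) = window w i k ++ [w (i + k)] := by
  rw [window, List.ofFn_succ_last]
  simp [window]

theorem window_add (w : BiWord A) (i : ℤ) (k l : ℕ) :
    window w i (k + l) = window w i k ++ window w (i + k) l := by
  induction l with
  | zero => simp [window]
  | succ l ih => rw [← add_assoc, window_succ', window_succ', ih]; simp [add_assoc]

theorem window_eq_iff {w v : BiWord A} {i j : ℤ} {k : ℕ} :
    window w i k = window v j k ↔ ∀ t < k, w (i + (t : ℕ)) = v (j + (t : ℕ)) := by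
  rw [window, window, List.ofFn_inj, funext_iff]
  exact ⟨fun h t ht => h ⟨t, ht⟩, fun h t => h t t.2⟩

theorem mem_lang {w : BiWord A} {s : List A} : s ∈ lang w ↔ ∃ i, s = window w i s.length := by
  refine exists_congr fun i => ?_
  conv_rhs => rw [← List.ofFn_get s, window]
  simp only [List.length_ofFn]
  constructor
  · intro h
    refine List.ext_get (by simp) fun k h1 h2 => ?_
    simp only [List.length_ofFn] at h1
    simpa using (h ⟨k, h1⟩).symm
  · intro h j
    have := List.getElem_of_eq h (i := j) (by simp)
    simpa using this.symm

theorem window_mem (w : BiWord A) (i : ℤ) (k : ℕ) : window w i k ∈ lang w :=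
  mem_lang.2 ⟨i, by simp⟩

theorem isFactorial_lang (w : BiWord A) : IsFactorial (lang w) where
  infix_mem {l l'} h hl' := by
    obtain ⟨s, t, rfl⟩ := h
    obtain ⟨i, hi⟩ := mem_lang.1 hl'
    rw [List.length_append, List.length_append, window_add, window_add] at hi
    have h1 := (List.append_inj hi (by simp)).1
    have h2 := (List.append_inj h1 (by simp)).2
    exact h2 ▸ window_mem w _ _
  exists_cons {l} hl := by
    obtain ⟨i, hi⟩ := mem_lang.1 hl
    refine ⟨w (i - 1), ?_⟩
    rw [hi]
    simpa [window_succ] using window_mem w (i - 1) (l.length + 1)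
  exists_concat {l} hl := by
    obtain ⟨i, hi⟩ := mem_lang.1 hl
    refine ⟨w (i + l.length), ?_⟩
    rw [hi, length_window, ← window_succ']
    exact window_mem w _ _

theorem window_shift (w : BiWord A) (a i : ℤ) (k : ℕ) :
    window (fun t => w (a + t)) i k = window w (a + i) k :=
  window_eq_iff.2 fun t _ => by rw [add_assoc]

theorem lang_shift (w : BiWord A) (a : ℤ) : lang (fun t => w (a + t)) = lang w := by
  ext s
  rw [mem_lang, mem_lang]
  constructor
  · rintro ⟨i, hi⟩
    exact ⟨a + i, by rwa [window_shift] at hi⟩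
  · rintro ⟨i, hi⟩
    exact ⟨i - a, by rw [window_shift]; simpa using hi⟩

theorem apply_eq_of_dvd {w : BiWord A} {n : ℕ} (h : Function.Periodic w (n : ℤ)) {i j : ℤ}
    (hij : (n : ℤ) ∣ i - j) : w i = w j := by
  obtain ⟨k, hk⟩ := hij
  have := h.int_mul k j
  rw [← this]
  congr 1
  simp only [Int.cast_eq]
  linarith

/-- The periodic word repeating the first `p` letters of `w` from position `0` on. -/
def loop (w : BiWord A) (p : ℕ) : BiWord A := fun t => w (t % p)

theorem loop_periodic (w : BiWord A) (p : ℕ) : Function.Periodic (loop w p) (p : ℤ) := by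
  intro t
  simp [loop]

section Split

variable {w : BiWord A} {n m p : ℕ}

/-- Because the block of length `m` at `0` recurs at `p`, the loop follows `w` for `m` letters past
its first period. -/
theorem loop_eq (hp : 0 < p) (hx : ∀ t < m, w (t : ℕ) = w (p + (t : ℕ))) (k : ℕ)
    (hk : k < p + m) : loop w p k = w k := by
  induction k using Nat.strong_induction_on with
  | _ k ih =>
    rcases lt_or_ge k p with h | h
    · simp only [loop]
      rw [Int.emod_eq_of_lt (by omega) (by omega)]
    · obtain ⟨t, rfl⟩ := Nat.exists_eq_add_of_le h
      have h1 := ih t (by omega) (by omega)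
      have h2 := loop_periodic w p t
      rw [hx t (by omega), add_comm] at h1
      rw [Nat.cast_add, add_comm, h2, h1]

theorem loop_window (hp : 0 < p) (hx : ∀ t < m, w (t : ℕ) = w (p + (t : ℕ))) (s : ℤ) {k : ℕ}
    (hk : s % p + k ≤ p + m) : window (loop w p) s k = window w (s % p) k := by
  have h0 : 0 ≤ s % p := Int.emod_nonneg _ (by omega)
  refine window_eq_iff.2 fun t ht => ?_
  have h1 : loop w p (s + t) = loop w p (s % p + t) :=
    apply_eq_of_dvd (loop_periodic w p) ⟨s / p, by rw [Int.emod_def]; ring⟩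
  have h2 := loop_eq hp hx (s % p + t).toNat (by omega)
  rw [Int.toNat_of_nonneg (by omega)] at h2
  rw [h1, h2]

/-- A period `r < p` would repeat the block of length `m + 1` at `0` and `r`, already in `w`,
although `0 < r < n`. -/
theorem loop_hasLeastPeriod
    (hinj : ∀ i j, window w i (m + 1) = window w j (m + 1) → (n : ℤ) ∣ i - j)
    (hp : 0 < p) (hpn : p < n) (hx : ∀ t < m, w (t : ℕ) = w (p + (t : ℕ))) :
    HasLeastPeriod (loop w p) p := by
  refine ⟨⟨hp, loop_periodic w p⟩, fun r ⟨hr, hper⟩ => ?_⟩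
  by_contra! hlt
  have h1 : window (loop w p) r (m + 1) = window (loop w p) 0 (m + 1) :=
    window_eq_iff.2 fun t _ => by rw [zero_add, add_comm]; exact hper t
  have hr' : (r : ℤ) % p = r := Int.emod_eq_of_lt (by omega) (by omega)
  rw [loop_window hp hx _ (by rw [hr']; push_cast; omega), hr',
    loop_window hp hx _ (by simp; omega)] at h1
  have h2 := Int.le_of_dvd (by simpa using hr) (hinj _ _ h1)
  simp at h2
  omega

theorem isSplit_loop (hA : ∀ a b e : A, a ≠ b → e = a ∨ e = b)
    (hper : Function.Periodic w (n : ℤ))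
    (hinj : ∀ i j, window w i (m + 1) = window w j (m + 1) → (n : ℤ) ∣ i - j)
    (hp : 0 < p) (hpn : p < n) (hx : ∀ t < m, w (t : ℕ) = w (p + (t : ℕ)))
    (hl : w (-1) ≠ w (p - 1)) (hr : w m ≠ w (p + m)) :
    IsSplit (lang w) (lang (loop w p)) (window w 0 m) (w (-1)) (w (p + m)) (w (p - 1)) (w m) := by
  have hp' : (p : ℤ) ≠ 0 := by omega
  have hxp : window w p m = window w 0 m :=
    window_eq_iff.2 fun t ht => by rw [zero_add]; exact (hx t ht).symm
  have hmod0 : ∀ s : ℤ, 0 ≤ s % p := fun s => Int.emod_nonneg _ hp'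
  have hmod : ∀ s : ℤ, s % p < p := fun s => Int.emod_lt_of_pos _ (by omega)
  -- Blocks of length `m + 1` of the loop are blocks of `w` starting in `[0, p)`, and `p < n`.
  have hinjU : ∀ i j, window (loop w p) i (m + 1) = window (loop w p) j (m + 1) →
      (p : ℤ) ∣ i - j := by
    intro i j h
    have hi := hmod i
    have hj := hmod j
    have hi0 := hmod0 i
    have hj0 := hmod0 j
    rw [loop_window hp hx _ (by push_cast; omega), loop_window hp hx _ (by push_cast; omega)] at h
    have h1 := Int.eq_zero_of_abs_lt_dvd (hinj _ _ h) (by rw [abs_lt]; constructor <;> omega)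
    exact Int.dvd_of_emod_eq_zero (Int.emod_eq_emod_iff_emod_sub_eq_zero.1 (by omega))
  have hm1 : ∀ (a : A) (z : List A), z.length = m + 1 → ∀ v : BiWord A, a :: z ∈ lang v →
      ∃ i, a = v (i - 1) ∧ z = window v i (m + 1) := by
    intro a z hz v h
    obtain ⟨i, hi⟩ := mem_lang.1 h
    rw [List.length_cons, hz, window_succ] at hi
    obtain ⟨h1, h2⟩ := List.cons.inj hi
    exact ⟨i + 1, by simpa using h1, h2⟩
  have hm2 : ∀ (a : A) (z : List A), z.length = m + 1 → ∀ v : BiWord A, z ++ [a] ∈ lang v →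
      ∃ i, z = window v i (m + 1) ∧ a = v (i + (m + 1 : ℕ)) := by
    intro a z hz v h
    obtain ⟨i, hi⟩ := mem_lang.1 h
    rw [List.length_append, hz, List.length_singleton, window_succ'] at hi
    obtain ⟨h1, h2⟩ := List.append_inj' hi rfl
    exact ⟨i, h1, by simpa using h2⟩
  have hcx : w (-1) :: window w 0 m = window w (-1) (m + 1) := by simp [window_succ]
  have hcx' : w (p - 1) :: window w 0 m = window w (p - 1) (m + 1) := by simp [window_succ, hxp]
  have hxd : window w 0 m ++ [w (p + m)] = window w p (m + 1) := by rw [window_succ', hxp]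
  have hxd' : window w 0 m ++ [w m] = window w 0 (m + 1) := by simp [window_succ']
  exact
  { factW := isFactorial_lang w
    factU := isFactorial_lang _
    detW := by
      intro z b b' hz h1 h2
      rw [length_window] at hz
      obtain ⟨i, hi, rfl⟩ := hm2 b z hz _ h1
      obtain ⟨j, hj, rfl⟩ := hm2 b' z hz _ h2
      exact apply_eq_of_dvd hper (by simpa using hinj i j (hi.symm.trans hj))
    codetW := by
      intro z b b' hz h1 h2
      rw [length_window] at hz
      obtain ⟨i, rfl, hi⟩ := hm1 b z hz _ h1
      obtain ⟨j, rfl, hj⟩ := hm1 b' z hz _ h2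
      exact apply_eq_of_dvd hper (by simpa using hinj i j (hi.symm.trans hj))
    detU := by
      intro z b b' hz h1 h2
      rw [length_window] at hz
      obtain ⟨i, hi, rfl⟩ := hm2 b z hz _ h1
      obtain ⟨j, hj, rfl⟩ := hm2 b' z hz _ h2
      exact apply_eq_of_dvd (loop_periodic w p) (by simpa using hinjU i j (hi.symm.trans hj))
    codetU := by
      intro z b b' hz h1 h2
      rw [length_window] at hz
      obtain ⟨i, rfl, hi⟩ := hm1 b z hz _ h1
      obtain ⟨j, rfl, hj⟩ := hm1 b' z hz _ h2
      exact apply_eq_of_dvd (loop_periodic w p) (by simpa using hinjU i j (hi.symm.trans hj))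
    sub := by
      intro l hl hlen
      rw [length_window] at hlen
      obtain ⟨i, hi⟩ := mem_lang.1 hl
      have := hmod i
      rw [loop_window hp hx _ (by omega)] at hi
      exact hi ▸ window_mem w _ _
    new := by
      intro l hl hlen
      rw [length_window] at hlen
      obtain ⟨i, hi⟩ := mem_lang.1 hl
      have h1 := hmod i
      -- A block of length `m + 2` is copied from `w` unless it starts at residue `p - 1`, where it
      -- is `c' x d'`.
      by_cases h2 : i % p + 1 < p
      · rw [loop_window hp hx _ (by omega)] at hi
        exact Or.inl (hi ▸ window_mem w _ _)
      · right
        have h3 : i % p = p - 1 := by omega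
        have h4 : (i + 1) % p = 0 := by
          rw [← Int.emod_add_emod, h3]; simp
        rw [hlen, window_succ] at hi
        rw [hi, loop_window hp hx _ (by rw [h4]; push_cast; omega), h4, hxd']
        simp [loop, h3]
    cons_eq := by
      intro a ha
      rcases hA _ _ a hl with rfl | rfl
      · exfalso
        obtain ⟨i, hi⟩ := mem_lang.1 ha
        have h1 := hmod i
        have h0 := hmod0 i
        rw [List.length_cons, length_window, loop_window hp hx _ (by push_cast; omega), hcx] at hi
        have := Int.le_of_dvd (by omega) (hinj _ _ hi.symm)
        omega
      · rfl
    concat_eq := by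
      intro a ha
      rcases hA _ _ a hr with rfl | rfl
      · rfl
      · exfalso
        obtain ⟨i, hi⟩ := mem_lang.1 ha
        have h1 := hmod i
        have h0 := hmod0 i
        rw [List.length_append, length_window, List.length_singleton,
          loop_window hp hx _ (by push_cast; omega), hxd] at hi
        have := Int.le_of_dvd (by omega) (hinj _ _ hi)
        omega
    memU := by
      have h1 := window_mem (loop w p) (-1) (m + 2)
      have h2 : loop w p (-1) = w (p - 1) := by
        simp only [loop]
        rw [← Int.add_emod_right, Int.emod_eq_of_lt (by omega) (by omega)]; ring_nf
      rw [window_succ, h2, loop_window hp hx _ (by simp; omega)] at h1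
      simpa [hxd'] using h1
    mem_right := by
      have h1 := window_mem w (p - 1) (m + 2)
      rw [window_succ] at h1
      simpa [hxd] using h1
    mem_left := by
      have h1 := window_mem w (-1) (m + 2)
      rw [window_succ] at h1
      simpa [hxd'] using h1
    ne_left := hl
    ne_right := hr.symm }

end Split

/-! ### The Fibonacci induction on the period -/

theorem singleton_mem_lang (hA : ∀ a b e : A, a ≠ b → e = a ∨ e = b) {w : BiWord A} {n : ℕ}
    (hw : HasLeastPeriod w n) (hn : 2 ≤ n) (a : A) : [a] ∈ lang w := by
  by_contra h
  have h1 : ∀ t, w t ≠ a := by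
    rintro t rfl
    exact h (by simpa [window_succ, window] using window_mem w t 1)
  have h2 : ∀ t, w t = w 0 := fun t => (hA _ _ (w t) (h1 0)).resolve_right (h1 t)
  have := hw.2 ⟨one_pos, fun t => by rw [h2, h2 t]⟩
  omega

theorem dvd_of_window_eq {w : BiWord A} {n : ℕ} (hw : HasLeastPeriod w n) {i j : ℤ}
    (h : window w i n = window w j n) : (n : ℤ) ∣ i - j := by
  obtain ⟨⟨hn, hper⟩, hmin⟩ := hw
  have hn' : (n : ℤ) ≠ 0 := by omega
  have h1 : ∀ t, w (i + t) = w (j + t) := by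
    intro t
    have h0 := Int.emod_nonneg t hn'
    have hlt := Int.emod_lt_of_pos t (b := n) (by omega)
    have h2 := window_eq_iff.1 h (t % n).toNat (by omega)
    rw [Int.toNat_of_nonneg h0] at h2
    have h3 : ∀ s, w (s + t) = w (s + t % n) := fun s =>
      apply_eq_of_dvd hper ⟨t / n, by rw [Int.emod_def]; ring⟩
    rw [h3, h3, h2]
  by_contra hnd
  have h0 := Int.emod_nonneg (i - j) hn'
  have hlt := Int.emod_lt_of_pos (i - j) (b := n) (by omega)
  have hne : (i - j) % n ≠ 0 := fun h => hnd (Int.dvd_of_emod_eq_zero h)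
  have := hmin (a := ((i - j) % n).toNat) ⟨by omega, fun t => by
    rw [Int.toNat_of_nonneg h0]
    have h2 : w (t + (i - j) % n) = w (t + (i - j)) :=
      apply_eq_of_dvd hper ⟨-((i - j) / n), by rw [Int.emod_def]; ring⟩
    have h3 := h1 (t - j)
    rw [h2]
    convert h3 using 2 <;> ring⟩
  omega

/-- A word of least period `n ≥ 2` can be shifted so that a longest repeated block occurs at the
positions `0` and `p` with `0 < p < n`. -/
theorem exists_longest_repeat {w : BiWord A} {n : ℕ} (hw : HasLeastPeriod w n) (hn : 2 ≤ n) :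
    ∃ (a : ℤ) (m p : ℕ), (∀ i j, window w i (m + 1) = window w j (m + 1) → (n : ℤ) ∣ i - j) ∧
      0 < p ∧ p < n ∧ window w a m = window w (a + p) m := by
  classical
  have hex : ∃ k, ∀ i j, window w i k = window w j k → (n : ℤ) ∣ i - j :=
    ⟨n, fun i j => dvd_of_window_eq hw⟩
  -- The least block length that determines the position modulo `n` is `m + 1`; blocks of length `m`
  -- still repeat.
  have hspec := Nat.find_spec hex
  have hmin := fun k => Nat.find_min hex (m := k)
  generalize Nat.find hex = k at hspec hmin
  obtain _ | m := k
  · have := Int.le_of_dvd (by omega) (hspec 1 0 (by simp [window]))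
    omega
  · have h1 := hmin m (by omega)
    push Not at h1
    obtain ⟨i, j, hij, hnd⟩ := h1
    have h0 := Int.emod_nonneg (j - i) (b := n) (by omega)
    have hlt := Int.emod_lt_of_pos (j - i) (b := n) (by omega)
    have hne : (j - i) % n ≠ 0 := fun h => hnd (by
      rw [← dvd_neg, neg_sub]; exact Int.dvd_of_emod_eq_zero h)
    refine ⟨i, m, ((j - i) % n).toNat, hspec, by omega, by omega, ?_⟩
    rw [Int.toNat_of_nonneg h0, hij]
    refine window_eq_iff.2 fun t _ => apply_eq_of_dvd hw.1.2 ⟨(j - i) / n, ?_⟩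
    rw [Int.emod_def]; ring

theorem le_fib_ncard_minForbidden [Finite A] (hA : ∀ a b e : A, a ≠ b → e = a ∨ e = b) (n : ℕ) :
    ∀ w : BiWord A, HasLeastPeriod w n → n ≤ Nat.fib ((minForbidden (lang w)).ncard + 1) := by
  induction n using Nat.strong_induction_on with
  | _ n ih =>
    intro w₀ hw₀
    rcases lt_or_ge n 2 with hn | hn
    · have : 0 < Nat.fib ((minForbidden (lang w₀)).ncard + 1) := Nat.fib_pos.2 (by omega)
      omega
    obtain ⟨a, m, p, hinj₀, hp, hpn, hrep⟩ := exists_longest_repeat hw₀ hn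
    obtain ⟨q, rfl⟩ := Nat.exists_eq_add_of_le hpn.le
    set w : BiWord A := fun t => w₀ (a + t) with hwdef
    have hper : Function.Periodic w ((p + q : ℕ) : ℤ) := fun t => by
      simp only [hwdef]; rw [← add_assoc]; exact hw₀.1.2 _
    have hinj : ∀ i j, window w i (m + 1) = window w j (m + 1) → ((p + q : ℕ) : ℤ) ∣ i - j := by
      intro i j h
      rw [hwdef, window_shift, window_shift] at h
      simpa using hinj₀ _ _ h
    have hx : ∀ t < m, w (t : ℕ) = w (p + (t : ℕ)) := fun t ht => by
      simpa [hwdef, add_assoc] using window_eq_iff.1 hrep t ht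
    have hndvd : ¬ ((p + q : ℕ) : ℤ) ∣ p := fun h => by
      have := Int.le_of_dvd (by omega) h; omega
    have hr : w m ≠ w (p + m) := fun h => hndvd <| by
      simpa using hinj p 0 (window_eq_iff.2 fun t ht => by
        rw [zero_add]
        rcases Nat.lt_succ_iff_lt_or_eq.1 ht with h1 | rfl
        · exact (hx t h1).symm
        · exact h.symm)
    -- By maximality of `m`, the two occurrences of `x` cannot be prolonged by equal letters on
    -- either side.
    have hl : w (-1) ≠ w (p - 1) := fun h => hndvd <| by
      simpa using hinj (p - 1) (-1) (by
        rw [window_succ, window_succ, h]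
        congr 1
        refine window_eq_iff.2 fun t ht => ?_
        simpa using (hx t ht).symm)
    -- Seen from the second occurrence of `x`, the complementary cut is a loop of length `q`, with
    -- `c, d` and `c', d'` exchanged.
    set v : BiWord A := fun t => w (p + t) with hvdef
    have hvper : Function.Periodic v ((p + q : ℕ) : ℤ) := fun t => by
      simp only [hvdef]; rw [← add_assoc]; exact hper _
    have hvinj : ∀ i j, window v i (m + 1) = window v j (m + 1) → ((p + q : ℕ) : ℤ) ∣ i - j := by
      intro i j h
      have h' : window w (p + i) (m + 1) = window w (p + j) (m + 1) := by
        rwa [← window_shift, ← window_shift]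
      simpa using hinj _ _ h'
    have hvq : ∀ t, v (q + t) = w t := fun t =>
      apply_eq_of_dvd hper ⟨1, by push_cast; ring⟩
    have hvx : ∀ t < m, v (t : ℕ) = v (q + (t : ℕ)) := fun t ht => by
      rw [hvq]; exact (hx t ht).symm
    have hq : 0 < q := by omega
    have hvl1 : v (-1) = w (p - 1) := rfl
    have hvl2 : v (q - 1) = w (-1) := by rw [sub_eq_add_neg]; exact hvq (-1)
    have hU := isSplit_loop hA hper hinj hp hpn hx hl hr
    have hV := isSplit_loop hA hvper hvinj hq (by omega) hvx (by rw [hvl1, hvl2]; exact hl.symm)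
      (by rw [hvq]; exact hr.symm)
    have hwin : window v 0 m = window w 0 m :=
      window_eq_iff.2 fun t ht => by simpa [hvdef] using (hx t ht).symm
    rw [hvl1, hvl2, hvq, hwin, show v m = w (p + m) from rfl, hvdef, lang_shift, ← hvdef] at hV
    have hWl : lang w₀ = lang w := (lang_shift w₀ a).symm
    rw [hWl]
    have hUp := loop_hasLeastPeriod hinj hp hpn hx
    have hVq := loop_hasLeastPeriod hvinj hq (by omega) hvx
    have hUn := hU.ncard_add_one_le hA
    have hVn := hV.ncard_add_one_le hA
    have hp1 := ih p hpn _ hUp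
    have hq1 := ih q (by omega) _ hVq
    have h2 := hU.ncard_ne_add_two_le
    obtain ⟨k, hk⟩ := Nat.exists_eq_add_of_le' ((Nat.le_add_left _ _).trans h2)
    rw [hk] at hUn hVn ⊢
    have hfib : Nat.fib (k + 2 + 1) = Nat.fib (k + 1) + Nat.fib (k + 2) := Nat.fib_add_two
    have hpos : 0 < Nat.fib (k + 1) := Nat.fib_pos.2 (by omega)
    have hp2 := hp1.trans (Nat.fib_mono (show _ ≤ k + 2 by omega))
    have hq2 := hq1.trans (Nat.fib_mono (show _ ≤ k + 2 by omega))
    -- A piece of length one is at most `fib (k + 1)` by positivity, so the stronger loss is needed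
    -- only when both pieces have length at least two.
    rcases lt_or_ge p 2 with hp3 | hp3
    · omega
    rcases lt_or_ge q 2 with hq3 | hq3
    · omega
    rcases hU.ncard_add_two_le hA hV (singleton_mem_lang hA hUp hp3)
      (singleton_mem_lang hA hVq hq3) with h3 | h3
    · have := hp1.trans (Nat.fib_mono (show _ ≤ k + 1 by omega))
      omega
    · have := hq1.trans (Nat.fib_mono (show _ ≤ k + 1 by omega))
      omega

/-! ### Minimal forbidden words against defining sets -/

/-- Glueing the past of one occurrence of `a y` with the future of one of `y b` gives a word all of
whose new subwords contain the minimal forbidden word `a y b`. -/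
theorem exists_word_of_mem_minForbidden {w : BiWord A} {t : A × List A × A}
    (ht : t ∈ minForbidden (lang w)) :
    ∃ h : BiWord A, toWord t ∈ lang h ∧ ∀ s ∈ lang h, s ∉ lang w → toWord t <:+: s := by
  obtain ⟨a, y, b⟩ := t
  obtain ⟨h1, h2, -⟩ := ht
  obtain ⟨i, hi⟩ := mem_lang.1 h1
  obtain ⟨j, hj⟩ := mem_lang.1 h2
  simp only [List.length_cons, List.length_append, List.length_nil, zero_add] at hi hj
  rw [window_succ] at hi
  rw [window_succ'] at hj
  obtain ⟨rfl, hyi⟩ := List.cons.inj hi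
  obtain ⟨hyj, hb⟩ := List.append_inj' hj rfl
  clear hi
  obtain rfl : b = w (j + y.length) := by simpa using hb
  clear hj hb
  generalize y.length = l at hyi hyj
  set h : BiWord A := fun k => if k ≤ l then w (i + k) else w (j - 1 + k) with hdef
  have hle : ∀ k : ℤ, k ≤ l → h k = w (i + k) := fun k hk => by simp [hdef, hk]
  -- On positions `1` to `l` both halves read `y`, so a block of `h` outside `lang w` must start at
  -- or before `0` and reach position `l + 1`.
  have hgt : ∀ k : ℤ, 1 ≤ k → h k = w (j - 1 + k) := by
    intro k hk
    rcases le_or_gt k l with h3 | h3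
    · rw [hle k h3]
      have := window_eq_iff.1 (hyi.symm.trans hyj) (k - 1).toNat (by omega)
      rw [Int.toNat_of_nonneg (by omega)] at this
      convert this using 2 <;> ring
    · simp [hdef, h3]
  have hword : toWord (w i, y, w (j + l)) = window h 0 (l + 2) := by
    rw [window_succ, window_succ', toWord, hle 0 (by omega), hgt _ (by omega)]
    simp only
    congr 1
    · simp
    · congr 1
      · exact hyi.trans (window_eq_iff.2 fun t ht => by rw [hle _ (by omega)]; ring_nf)
      · ring_nf
  refine ⟨h, hword ▸ window_mem h _ _, fun s hs hsw => ?_⟩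
  obtain ⟨k, hk⟩ := mem_lang.1 hs
  have hk0 : k ≤ 0 := by
    by_contra! hk0
    refine hsw (mem_lang.2 ⟨j - 1 + k, hk.trans (window_eq_iff.2 fun t _ => ?_)⟩)
    rw [hgt _ (by omega), add_assoc]
  have hkl : (l : ℤ) + 2 ≤ k + s.length := by
    by_contra! hkl
    refine hsw (mem_lang.2 ⟨i + k, hk.trans (window_eq_iff.2 fun t _ => ?_)⟩)
    rw [hle _ (by omega), add_assoc]
  obtain ⟨k', rfl⟩ : ∃ k' : ℕ, k = -k' := ⟨(-k).toNat, by omega⟩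
  obtain ⟨r, hr⟩ : ∃ r : ℕ, s.length = k' + (l + 2) + r :=
    Nat.exists_eq_add_of_le (by omega)
  rw [hr, window_add, window_add] at hk
  rw [neg_add_cancel, ← hword] at hk
  exact ⟨_, _, hk.symm⟩

/-- The glued word for `t` contains some `s ∈ S`, and `s` contains `t`. Any other minimal forbidden
word inside `s` occurs in the glued word and hence contains `t`; so two words sharing the same `s`
contain each other. -/
theorem ncard_minForbidden_le {w : BiWord A} {S : Finset (List A)}
    (hS : w.DefinedBy (S : Set (List A))) :
    (minForbidden (lang w)).ncard ≤ S.card := by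
  have key : ∀ t ∈ minForbidden (lang w), ∃ s ∈ S, toWord t <:+: s ∧
      ∀ t' ∈ minForbidden (lang w), toWord t' <:+: s → toWord t <:+: toWord t' := by
    intro t ht
    obtain ⟨h, hth, hh⟩ := exists_word_of_mem_minForbidden ht
    have hns : ¬ h.Satisfies (S : Set (List A)) := by
      intro hsat
      obtain ⟨k, hk⟩ := hS.2 h hsat
      have : h = fun i => w (k + i) := funext fun i => by rw [hk, add_comm]
      rw [this, lang_shift] at hth
      exact ht.2.2 hth
    simp only [Satisfies, not_forall, not_not] at hns
    obtain ⟨s, hsS, hs⟩ := hns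
    refine ⟨s, hsS, hh s hs (hS.1 s hsS), fun t' ht' hts => ?_⟩
    exact hh _ ((isFactorial_lang h).infix_mem hts hs) ht'.2.2
  choose! φ hφ hinf hmin using key
  rw [← Set.ncard_coe_finset]
  refine Set.ncard_le_ncard_of_injOn φ hφ (fun t ht t' ht' h => toWord_injective ?_)
    S.finite_toSet
  have h1 := hmin t ht t' ht' (h ▸ hinf t' ht')
  have h2 := hmin t' ht' t ht (h ▸ hinf t ht)
  exact h1.eq_of_length (le_antisymm h1.length_le h2.length_le)

theorem fib_succ_le_goldenRatio_pow (c : ℕ) : (Nat.fib (c + 1) : ℝ) ≤ Real.goldenRatio ^ c := by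
  induction c using Nat.twoStepInduction with
  | zero => simp
  | one => simpa using Real.one_lt_goldenRatio.le
  | more c h1 h2 =>
    rw [show c + 2 + 1 = c + 1 + 2 from rfl, Nat.fib_add_two, pow_add, Real.goldenRatio_sq]
    push_cast
    rw [pow_succ] at h2
    linarith

end ForbiddenWords

theorem mainTheorem1 {A : Type*} (hA : Nat.card A = 2) (n c : ℕ) (w : BiWord A)
    (hw : w.HasLeastPeriod n) (S : Finset (List A)) (hc : S.card = c)
    (hS : w.DefinedBy (S : Set (List A))) :
    n ≤ Nat.fib (c + 1) ∧ Real.logb Real.goldenRatio n ≤ c := by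
  have hfin : Finite A := Nat.finite_of_card_ne_zero (by omega)
  have hA' : ∀ a b e : A, a ≠ b → e = a ∨ e = b := by
    intro a b e hab
    obtain ⟨x, y, hxy, huniv⟩ := Nat.card_eq_two_iff.1 hA
    have h : ∀ z : A, z = x ∨ z = y := fun z => by simpa using huniv.ge (Set.mem_univ z)
    rcases h a with rfl | rfl <;> rcases h b with rfl | rfl <;> rcases h e with rfl | rfl <;>
      simp_all
  have hn : n ≤ Nat.fib (c + 1) :=
    (ForbiddenWords.le_fib_ncard_minForbidden hA' n w hw).trans
      (Nat.fib_mono (by have := ForbiddenWords.ncard_minForbidden_le hS; omega))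
  refine ⟨hn, ?_⟩
  have hn0 : 0 < n := hw.1.1
  rw [Real.logb_le_iff_le_rpow Real.one_lt_goldenRatio (by exact_mod_cast hn0), Real.rpow_natCast]
  exact (Nat.cast_le.2 hn).trans (ForbiddenWords.fib_succ_le_goldenRatio_pow c)
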